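/- Let $d\ge 1$. A real $d\times d$ matrix is called expanding if all its complex eigenvalues have absolute value larger than $1$. A nonempty compact set $G\subset\mathbb{R}^d$ is the attractor generated by an expanding matrix $M\in\mathbb{R}^{d\times d}$ and a finite set of shifts $S\subset\mathbb{R}^d$ if $G=\bigcup_{s\in S}M^{-1}(G+s)$ and the sets $M^{-1}(G+s)$, $s\in S$, have pairwise intersections of Lebesgue measure zero. An attractor $G$ generated by $M$ and $S$ is irreducible if it is not, in any basis of $\mathbb{R}^d$, a tensor product of two attractors; that is, there are no $d_1,d_2\ge 1$ with $d_1+d_2=d$, attractors $G_j\subset\mathbb{R}^{d_j}$ generated by $M_j,S_j$ ($j=1,2$) and linear isomorphism $\varphi:\mathbb{R}^{d_1}\times\mathbb{R}^{d_2}\to\mathbb{R}^d$ such that $G=\varphi(G_1\times G_2)$, $S=\varphi(S_1\times S_2)$ and $\varphi^{-1}M\varphi$ is the block-diagonal matrix with blocks $M_1,M_2$. A box-attractor is an attractor that is a nondegenerate (not necessarily rectangular) parallelepiped in $\mathbb{R}^d$. Theorem. Let $M\in\mathbb{Z}^{d\times d}$ be an expanding matrix. The following conditions are equivalent: (a) there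 exists an irreducible box-attractor generated by $M$ and some finite set of integer shifts $S\subset\mathbb{Z}^d$; (b) there is a basis of $\mathbb{R}^d$ consisting of vectors of $\mathbb{Z}^d$ in which the linear map $x\mapsto Mx$ has the matrix $$\begin{pmatrix} 0 & p_1 & 0 & \ldots & 0\\ 0 & 0 & p_2 & \ldots & 0\\ \ldots & \ldots & \ldots & \ldots &\ldots \\ 0 & 0 & 0 & \ldots & p_{d - 1} \\ \pm p_d & 0 & 0 & \ldots & 0 \end{pmatrix}$$ (for $d=1$, the matrix $(\pm p_1)$), where $p_1,\dots,p_d$ are positive integers with $\prod_{i=1}^d p_i=|\det M|$. Moreover, $\prod_{i=1}^d p_i=|\det M|$ holds for every basis and every $p_1,\dots,p_d$ as in (b). -/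

import Mathlib

open scoped Matrix

namespace BoxAttractor

/-- A real square matrix is expanding if all its complex eigenvalues are larger than one
in absolute value. -/
def IsExpanding {d : ℕ} (M : Matrix (Fin d) (Fin d) ℝ) : Prop :=
  ∀ z ∈ spectrum ℂ (M.map (algebraMap ℝ ℂ)), 1 < ‖z‖

/-- Vectors of `ℝ^d` with integer coordinates. -/
def IsIntegerVector {d : ℕ} (x : Fin d → ℝ) : Prop :=
  ∃ z : Fin d → ℤ, x = fun i => (z i : ℝ)

/-- The contracted copy `M⁻¹ (G + s)`. -/
def piece {d : ℕ} (M : Matrix (Fin d) (Fin d) ℝ) (G : Set (Fin d → ℝ)) (s : Fin d → ℝ) :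
    Set (Fin d → ℝ) :=
  (fun x => M⁻¹ *ᵥ (x + s)) '' G

/-- `G` is the attractor generated by the expanding matrix `M` and the finite set of shifts `S`:
a nonempty compact set that is the union of the sets `M⁻¹ (G + s)`, `s ∈ S`, which have pairwise
intersections of Lebesgue measure zero. -/
structure IsAttractor {d : ℕ} (M : Matrix (Fin d) (Fin d) ℝ) (S G : Set (Fin d → ℝ)) :
    Prop where
  expanding : IsExpanding M
  finite_shifts : S.Finite
  nonempty : G.Nonempty
  isCompact : IsCompact G
  eq_iUnion : G = ⋃ s ∈ S, piece M G s
  null_inter : ∀ s ∈ S, ∀ t ∈ S, s ≠ t →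
    MeasureTheory.volume (piece M G s ∩ piece M G t) = 0

/-- The attractor `G` (with its matrix `M` and shifts `S`) is, in a suitable basis of `ℝ^d`, the
tensor product of two attractors of positive dimensions: the set is `G₁ × G₂`, the matrix is the
block-diagonal matrix with blocks `M₁`, `M₂`, and the set of shifts is `S₁ × S₂`.
The change of basis is the linear isomorphism `φ`. -/
def IsTensorProduct {d : ℕ} (M : Matrix (Fin d) (Fin d) ℝ) (S G : Set (Fin d → ℝ)) : Prop :=
  ∃ (d₁ d₂ : ℕ) (_ : 0 < d₁) (_ : 0 < d₂)
    (M₁ : Matrix (Fin d₁) (Fin d₁) ℝ) (S₁ G₁ : Set (Fin d₁ → ℝ))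
    (M₂ : Matrix (Fin d₂) (Fin d₂) ℝ) (S₂ G₂ : Set (Fin d₂ → ℝ))
    (φ : ((Fin d₁ → ℝ) × (Fin d₂ → ℝ)) ≃ₗ[ℝ] (Fin d → ℝ)),
    IsAttractor M₁ S₁ G₁ ∧ IsAttractor M₂ S₂ G₂ ∧
    (∀ x y, M *ᵥ φ (x, y) = φ (M₁ *ᵥ x, M₂ *ᵥ y)) ∧
    S = φ '' (S₁ ×ˢ S₂) ∧
    G = φ '' (G₁ ×ˢ G₂)

/-- `G` is an irreducible attractor generated by `M` and `S`. -/
def IsIrreducibleAttractor {d : ℕ} (M : Matrix (Fin d) (Fin d) ℝ) (S G : Set (Fin d → ℝ)) :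
    Prop :=
  IsAttractor M S G ∧ ¬ IsTensorProduct M S G

/-- `G` is a (nondegenerate, not necessarily rectangular) parallelepiped in `ℝ^d`. -/
def IsParallelepiped {d : ℕ} (G : Set (Fin d → ℝ)) : Prop :=
  ∃ (v : Fin d → ℝ) (e : Module.Basis (Fin d) ℝ (Fin d → ℝ)),
    G = (fun x => v + x) '' parallelepiped e

/-- The cyclic weighted permutation matrix: `p 0, …, p (d - 2)` directly above the diagonal,
`ε * p (d - 1)` in the lower left corner, and zeros elsewhere. For `d = 1` it is `(ε * p 0)`. -/
def cyclicMatrix {d : ℕ} (ε : ℤˣ) (p : Fin d → ℕ) : Matrix (Fin d) (Fin d) ℤ :=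
  Matrix.of fun i j =>
    if (j : ℕ) = i + 1 then (p i : ℤ)
    else if (i : ℕ) + 1 = d ∧ (j : ℕ) = 0 then (ε : ℤ) * p i
    else 0

/-- In the basis `b` of `ℝ^d`, which consists of integer vectors, the linear map given by the
integer matrix `M` has the matrix `cyclicMatrix ε p`, where all `p i` are positive integers. -/
def HasCyclicForm {d : ℕ} (M : Matrix (Fin d) (Fin d) ℤ)
    (b : Module.Basis (Fin d) ℝ (Fin d → ℝ)) (ε : ℤˣ) (p : Fin d → ℕ) : Prop :=
  (∀ i, IsIntegerVector (b i)) ∧ (∀ i, 0 < p i) ∧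
    LinearMap.toMatrix b b (Matrix.toLin' (M.map (Int.cast : ℤ → ℝ))) =
      (cyclicMatrix ε p).map (Int.cast : ℤ → ℝ)

end BoxAttractor

/-!
A box `G` with edges `e i` that is generated by `M` determines how `M` acts on the edges. This is
read off from the integrals `∫_G exp (η x) dx` over all complex-valued real-linear functionals `η`.
Up to a nonzero factor the integral is the product over the edges of `∫_0^1 exp (t η (e i)) dt`, so
it vanishes exactly if some `η (e i)` is a nonzero integer multiple of `2π√-1`
(`expTransform_parallelepiped_eq_zero_iff`). The equation `G = ⋃ M⁻¹ (G + s)` turns into a functional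
equation: the integral for `η ∘ M` is the integral for `η`, times an exponential sum over the shifts
`s` (`IsAttractor.expTransform_comp`). This has two consequences.

* If `η (e i) = 2π√-1` and `η` takes generic real values on the other edges, then the integral for
  `η ∘ M` vanishes as well, which forces some `M e_j` to be a nonzero integer multiple of `e i`
  (`IsAttractor.exists_mulVec_basis_eq`). Hence `M e_(τ i) = k_i e_i` for a permutation `τ` and
  nonzero integers `k_i`.
* For real `η` the integral does not vanish, so the exponential sum, and with it the set of shifts,
  is determined by `M` and `G` (`IsAttractor.shifts_unique`). As the obvious grid of shifts generates
  `G` (`isAttractor_box`), it is the only possible set of shifts.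

If `τ` is not a single cycle, the box and its grid split along a `τ`-invariant set of edges, and `G`
is a tensor product (`isTensorProduct_box_of_not_isCycleOn`). So for an irreducible `G` the
permutation is a `d`-cycle, and `M ^ d` multiplies each edge by `∏ k_i`. Since `M` is expanding, some
`|k_j|` is at least two; then `e j` is a difference of two shifts of the grid, thus an integer vector,
and `M ^ (d - 1) e_j, …, M e_j, e_j` is a basis as required, with `p_1 = … = p_(d-1) = 1`
(`exists_hasCyclicForm_of_isCycleOn`).

Conversely, the cyclic form says that `M` permutes the edges of the parallelepiped spanned by `b`
cyclically, with integer factors, so the parallelepiped with the grid of shifts is an attractor. In a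
decomposition as a product each edge lies in one of the factors
(`symm_basis_fst_eq_zero_or_snd_eq_zero`). The factors are invariant under `M`, so that one of them
contains all edges, and the other one is trivial (`not_isTensorProduct_of_isCycleOn`).
-/

namespace BoxAttractor

open MeasureTheory Complex

/-! ### The exponential transform of a parallelepiped -/

/-- The integral of the exponential of a complex-valued linear functional over a set. For purely
imaginary functionals it is the Fourier transform of the indicator function of the set, for real
ones its Laplace transform. -/
noncomputable def expTransform {d : ℕ} (G : Set (Fin d → ℝ)) (η : (Fin d → ℝ) →ₗ[ℝ] ℂ) : ℂ :=
  ∫ x in G, exp (η x)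

theorem integral_Icc_exp_mul_eq_zero_iff (z : ℂ) :
    ∫ t in Set.Icc (0 : ℝ) 1, exp (z * t) = 0 ↔
      ∃ n : ℤ, n ≠ 0 ∧ z = n * (2 * Real.pi * I) := by
  rw [integral_Icc_eq_integral_Ioc, ← intervalIntegral.integral_of_le zero_le_one]
  by_cases hz : z = 0
  · simp [hz, Real.pi_ne_zero, I_ne_zero]
  · rw [integral_exp_mul_complex hz, div_eq_zero_iff, or_iff_left hz]
    simp only [ofReal_one, mul_one, ofReal_zero, mul_zero, exp_zero, sub_eq_zero, exp_eq_one_iff]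
    refine exists_congr fun n => ⟨fun h => ⟨?_, h⟩, fun h => h.2⟩
    rintro rfl
    exact hz (by simpa using h)

theorem continuous_exp_linear {d : ℕ} (η : (Fin d → ℝ) →ₗ[ℝ] ℂ) :
    Continuous fun x => exp (η x) :=
  continuous_exp.comp η.continuous_of_finiteDimensional

/-- Up to a nonzero factor, the exponential transform of a parallelepiped is the product of the
transforms of its edges. -/
theorem expTransform_parallelepiped {d : ℕ} (v : Fin d → ℝ)
    (e : Module.Basis (Fin d) ℝ (Fin d → ℝ)) (η : (Fin d → ℝ) →ₗ[ℝ] ℂ) :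
    ∃ C : ℂ, C ≠ 0 ∧ expTransform ((fun x => v + x) '' parallelepiped e) η =
      C * ∏ i, ∫ t in Set.Icc (0 : ℝ) 1, exp (η (e i) * t) := by
  set A : (Fin d → ℝ) →L[ℝ] (Fin d → ℝ) :=
    LinearMap.toContinuousLinearMap (e.equivFun.symm : (Fin d → ℝ) →ₗ[ℝ] (Fin d → ℝ)) with hA
  have hAt : ∀ t, A t = ∑ i, t i • e i := fun t => by simp [hA, e.equivFun_symm_apply]
  have hG : (fun x => v + x) '' parallelepiped e = (fun t => v + A t) '' Set.Icc 0 1 := by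
    rw [parallelepiped, Set.image_image]
    simp only [hAt]
  have hdet : A.det ≠ 0 := (LinearEquiv.isUnit_det' e.equivFun.symm).ne_zero
  refine ⟨(|A.det| : ℝ) * exp (η v), mul_ne_zero (by simpa using hdet) (exp_ne_zero _), ?_⟩
  have hinj : Function.Injective fun t => v + A t :=
    (add_right_injective v).comp e.equivFun.symm.injective
  rw [expTransform, hG, integral_image_eq_integral_abs_det_fderiv_smul volume
    measurableSet_Icc (f' := fun _ => A)
    (fun t _ => (A.hasFDerivAt.const_add v).hasFDerivWithinAt) hinj.injOn, integral_smul]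
  rw [← Set.pi_univ_Icc, volume_pi, Measure.restrict_pi_pi]
  have : ∀ t : Fin d → ℝ, exp (η (v + A t)) = exp (η v) * ∏ i, exp (η (e i) * (t i : ℝ)) := by
    intro t
    rw [map_add, exp_add, hAt, map_sum, exp_sum]
    simp [mul_comm]
  simp only [this]
  rw [integral_const_mul, integral_fintype_prod_eq_prod
    (fun i (t : ℝ) => exp (η (e i) * (t : ℝ)))]
  simp [mul_assoc]

theorem expTransform_parallelepiped_eq_zero_iff {d : ℕ} (v : Fin d → ℝ)
    (e : Module.Basis (Fin d) ℝ (Fin d → ℝ)) (η : (Fin d → ℝ) →ₗ[ℝ] ℂ) :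
    expTransform ((fun x => v + x) '' parallelepiped e) η = 0 ↔
      ∃ i, ∃ n : ℤ, n ≠ 0 ∧ η (e i) = n * (2 * Real.pi * I) := by
  obtain ⟨C, hC, h⟩ := expTransform_parallelepiped v e η
  rw [h, mul_eq_zero, or_iff_right hC, Finset.prod_eq_zero_iff]
  simp only [integral_Icc_exp_mul_eq_zero_iff, Finset.mem_univ, true_and]

/-! ### The transform of an attractor -/

theorem IsExpanding.isUnit_det {d : ℕ} {M : Matrix (Fin d) (Fin d) ℝ} (hM : IsExpanding M) :
    IsUnit M.det := by
  have h0 : (0 : ℂ) ∉ spectrum ℂ (M.map (algebraMap ℝ ℂ)) := fun h => by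
    have := hM 0 h
    norm_num at this
  have h := (Matrix.isUnit_iff_isUnit_det _).1 (spectrum.isUnit_of_zero_notMem ℂ h0)
  have hd : (M.map (algebraMap ℝ ℂ)).det = algebraMap ℝ ℂ M.det := by
    rw [RingHom.map_det, RingHom.mapMatrix_apply]
  rw [hd, isUnit_iff_ne_zero] at h
  rw [isUnit_iff_ne_zero]
  rintro h'
  exact h (by simp [h'])

theorem mem_piece_iff {d : ℕ} {M : Matrix (Fin d) (Fin d) ℝ} (hM : IsUnit M.det)
    {G : Set (Fin d → ℝ)} {s x : Fin d → ℝ} : x ∈ piece M G s ↔ M *ᵥ x - s ∈ G := by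
  constructor
  · rintro ⟨y, hy, rfl⟩
    simpa [Matrix.mulVec_mulVec, Matrix.mul_nonsing_inv _ hM] using hy
  · intro h
    exact ⟨_, h, by simp [Matrix.mulVec_mulVec, Matrix.nonsing_inv_mul _ hM]⟩

/-- The self-similarity of an attractor, seen by the exponential transform: the transform at
`η ∘ M` is the transform at `η` times an exponential sum over the shifts. -/
theorem IsAttractor.expTransform_comp {d : ℕ} {M : Matrix (Fin d) (Fin d) ℝ}
    {S G : Set (Fin d → ℝ)} (h : IsAttractor M S G) (η : (Fin d → ℝ) →ₗ[ℝ] ℂ) :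
    expTransform G (η ∘ₗ Matrix.toLin' M) =
      (|M⁻¹.det| : ℝ) * (∑ s ∈ h.finite_shifts.toFinset, exp (η s)) * expTransform G η := by
  have hu := h.expanding.isUnit_det
  have hpc : ∀ s, IsCompact (piece M G s) := fun s =>
    h.isCompact.image (by fun_prop)
  have := h.finite_shifts.fintype
  have hG : G = ⋃ s : S, piece M G s := by
    conv_lhs => rw [h.eq_iUnion]
    rw [Set.biUnion_eq_iUnion]
  have hint : IntegrableOn (fun x => exp ((η ∘ₗ Matrix.toLin' M) x)) G :=
    (continuous_exp_linear _).continuousOn.integrableOn_compact h.isCompact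
  have hpiece : ∀ s, ∫ x in piece M G s, exp ((η ∘ₗ Matrix.toLin' M) x) =
      (|M⁻¹.det| : ℝ) * exp (η s) * expTransform G η := by
    intro s
    set A : (Fin d → ℝ) →L[ℝ] (Fin d → ℝ) := LinearMap.toContinuousLinearMap (Matrix.toLin' M⁻¹)
      with hA
    have hAd : A.det = M⁻¹.det := LinearMap.det_toLin' _
    have hinj : Function.Injective fun x => M⁻¹ *ᵥ (x + s) := by
      intro x y hxy
      have := congrArg (M *ᵥ ·) hxy
      simpa [Matrix.mulVec_mulVec, Matrix.mul_nonsing_inv _ hu] using this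
    have hder : ∀ x ∈ G, HasFDerivWithinAt (fun x => M⁻¹ *ᵥ (x + s)) A G x := fun x _ =>
      (A.hasFDerivAt.comp x ((hasFDerivAt_id x).add_const s)).hasFDerivWithinAt
    rw [piece, integral_image_eq_integral_abs_det_fderiv_smul volume
      h.isCompact.measurableSet hder hinj.injOn, integral_smul, hAd]
    have : ∀ x, exp ((η ∘ₗ Matrix.toLin' M) (M⁻¹ *ᵥ (x + s))) = exp (η s) * exp (η x) := by
      intro x
      rw [LinearMap.comp_apply, Matrix.toLin'_apply, Matrix.mulVec_mulVec,
        Matrix.mul_nonsing_inv _ hu, Matrix.one_mulVec, map_add, exp_add, mul_comm]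
    simp only [this]
    rw [integral_const_mul, expTransform, real_smul, mul_assoc]
  conv_lhs => rw [expTransform, hG]
  rw [integral_iUnion_ae (s := fun s : S => piece M G s)
    (fun s => (hpc s).measurableSet.nullMeasurableSet)
    (fun s t hst => h.null_inter s s.2 t t.2 (Subtype.coe_injective.ne hst))
    (by rw [← hG]; exact hint), tsum_fintype]
  simp only [hpiece]
  rw [← Finset.sum_mul, ← Finset.mul_sum]
  congr 2
  rw [Finset.sum_subtype (p := (· ∈ S)) h.finite_shifts.toFinset (by simp) (fun s => exp (η s))]

/-! ### Uniqueness of the shifts -/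

/-- Evaluation of exponentials of real linear functionals at a fixed vector, as a character of
the dual space. -/
noncomputable def expChar {d : ℕ} (s : Fin d → ℝ) :
    Multiplicative ((Fin d → ℝ) →ₗ[ℝ] ℝ) →* ℂ where
  toFun ξ := exp ((ξ.toAdd s : ℝ) : ℂ)
  map_one' := by simp
  map_mul' ξ ζ := by simp [exp_add]

theorem expChar_injective {d : ℕ} : Function.Injective (expChar (d := d)) := by
  intro s t hst
  ext i
  have := DFunLike.congr_fun hst (Multiplicative.ofAdd (LinearMap.proj i))
  simp only [expChar, MonoidHom.coe_mk, OneHom.coe_mk, toAdd_ofAdd, LinearMap.proj_apply,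
    ← ofReal_exp, ofReal_inj] at this
  exact Real.exp_injective this

theorem eq_of_sum_exp_eq {d : ℕ} {S T : Finset (Fin d → ℝ)}
    (h : ∀ ξ : (Fin d → ℝ) →ₗ[ℝ] ℝ,
      ∑ s ∈ S, exp ((ξ s : ℝ) : ℂ) = ∑ s ∈ T, exp ((ξ s : ℝ) : ℂ)) : S = T := by
  have hli : LinearIndependent ℂ fun s : Fin d → ℝ => (expChar s : _ → ℂ) :=
    (linearIndependent_monoidHom _ ℂ).comp _ expChar_injective
  have hsum : ∀ U : Finset (Fin d → ℝ), Finsupp.linearCombination ℂ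
      (fun s : Fin d → ℝ => (expChar s : _ → ℂ)) (Finsupp.indicator U fun _ _ => 1) =
      fun ξ : Multiplicative ((Fin d → ℝ) →ₗ[ℝ] ℝ) =>
        ∑ s ∈ U, exp ((ξ.toAdd s : ℝ) : ℂ) := by
    intro U
    rw [Finsupp.linearCombination_apply, Finsupp.sum_of_support_subset _
      (Finsupp.support_indicator_subset _ _) _ (by simp)]
    ext ξ
    rw [Finset.sum_apply]
    refine Finset.sum_congr rfl fun s hs => ?_
    simp [Finsupp.indicator_of_mem hs, expChar]
  have := hli ((hsum S).trans ((funext fun ξ => h (Multiplicative.toAdd ξ)).trans (hsum T).symm))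
  ext s
  have hs := DFunLike.congr_fun this s
  simp only [Finsupp.indicator_apply] at hs
  by_cases h1 : s ∈ S <;> by_cases h2 : s ∈ T <;> simp_all

/-- A box is generated by a given matrix with at most one set of shifts: at real functionals its
transform does not vanish, so the exponential sum over the shifts is determined. -/
theorem IsAttractor.shifts_unique {d : ℕ} {M : Matrix (Fin d) (Fin d) ℝ}
    {S T G : Set (Fin d → ℝ)} (hS : IsAttractor M S G) (hT : IsAttractor M T G)
    (hG : IsParallelepiped G) : S = T := by
  obtain ⟨v, e, rfl⟩ := hG
  have key : hS.finite_shifts.toFinset = hT.finite_shifts.toFinset := by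
    refine eq_of_sum_exp_eq fun ξ => ?_
    set η : (Fin d → ℝ) →ₗ[ℝ] ℂ := ofRealCLM.toLinearMap ∘ₗ ξ with hη
    have hne : expTransform ((fun x => v + x) '' parallelepiped e) η ≠ 0 := by
      rw [Ne, expTransform_parallelepiped_eq_zero_iff]
      rintro ⟨i, n, hn, h⟩
      have := congrArg Complex.im h
      simp [hη, hn, Real.pi_ne_zero] at this
    have hdet : ((|M⁻¹.det| : ℝ) : ℂ) ≠ 0 := by
      have := Matrix.isUnit_nonsing_inv_det M hS.expanding.isUnit_det
      simpa using this.ne_zero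
    have h := (hS.expTransform_comp η).symm.trans (hT.expTransform_comp η)
    exact mul_left_cancel₀ hdet (mul_right_cancel₀ hne h)
  simpa using key

/-! ### The matrix of a box-attractor permutes the edge directions -/

/-- The zeros of the transform of a box lie on the hyperplanes `η (e i) = 2πn√-1`, `n ≠ 0`. Each
zero `η` of the transform of a box-attractor gives the zero `η ∘ M`; comparing the hyperplanes,
each edge is an integer fraction of the image of some edge. -/
theorem IsAttractor.exists_mulVec_basis_eq {d : ℕ} {M : Matrix (Fin d) (Fin d) ℝ}
    {S : Set (Fin d → ℝ)} {v : Fin d → ℝ} {e : Module.Basis (Fin d) ℝ (Fin d → ℝ)}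
    (h : IsAttractor M S ((fun x => v + x) '' parallelepiped e)) (i : Fin d) :
    ∃ (j : Fin d) (k : ℤ), k ≠ 0 ∧ M *ᵥ e j = (k : ℝ) • e i := by
  -- `u j` is the component of `M e_j` transversal to `e i`; a generic real functional does not
  -- vanish on the nonzero ones.
  set u : Fin d → (Fin d → ℝ) := fun j => M *ᵥ e j - e.repr (M *ᵥ e j) i • e i with hu
  obtain ⟨r, hr⟩ := Module.exists_dual_forall_apply_ne_zero (K := ℝ)
    (fun j : {j // u j ≠ 0} => u j) (fun j => j.2)
  set η : (Fin d → ℝ) →ₗ[ℝ] ℂ :=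
    ofRealCLM.toLinearMap ∘ₗ r ∘ₗ (LinearMap.id - (e.coord i).smulRight (e i)) +
      (e.coord i).smulRight (2 * Real.pi * I : ℂ) with hη
  have hηx : ∀ x, η x = (r (x - e.repr x i • e i) : ℝ) + (e.repr x i : ℝ) * (2 * Real.pi * I) := by
    intro x
    simp [hη]
  have hzero : expTransform ((fun x => v + x) '' parallelepiped e) η = 0 := by
    rw [expTransform_parallelepiped_eq_zero_iff]
    exact ⟨i, 1, one_ne_zero, by simp [hηx]⟩
  have hzero' := h.expTransform_comp η
  rw [hzero, mul_zero, expTransform_parallelepiped_eq_zero_iff] at hzero'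
  obtain ⟨j, k, hk, hjk⟩ := hzero'
  rw [LinearMap.comp_apply, Matrix.toLin'_apply, hηx] at hjk
  have hre : r (u j) = 0 := by simpa [hu] using congrArg Complex.re hjk
  have him : e.repr (M *ᵥ e j) i = k := by
    have := congrArg Complex.im hjk
    simpa [Real.pi_ne_zero] using this
  refine ⟨j, k, hk, ?_⟩
  by_contra hne
  refine hr ⟨j, fun h0 => hne ?_⟩ hre
  rw [← him]
  exact sub_eq_zero.1 h0

/-! ### Boxes and their grids of shifts -/

/-- The parallelepiped of all points whose coordinates in the basis `e` lie in the unit intervals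
`[w i, w i + 1]`. -/
def box {d : ℕ} (e : Module.Basis (Fin d) ℝ (Fin d → ℝ)) (w : Fin d → ℝ) : Set (Fin d → ℝ) :=
  {x | ∀ i, e.repr x i ∈ Set.Icc (w i) (w i + 1)}

/-- The shifts that put copies of `box e w` side by side, so that they fill the image of
`box e w` under the linear map with `e (τ i) ↦ k i • e i`. In the direction `e i` this image has
side `|k i|` and extends from `k i * w (τ i)` upwards if `0 < k i` and downwards if `k i < 0`; so
the copies are offset from `k i * w (τ i)` by the integers in `[0, k i)` or `[k i, 0)`. -/
def gridShifts {d : ℕ} (e : Module.Basis (Fin d) ℝ (Fin d → ℝ)) (τ : Equiv.Perm (Fin d))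
    (k : Fin d → ℤ) (w : Fin d → ℝ) : Set (Fin d → ℝ) :=
  {s | ∀ i, ∃ m ∈ Finset.Ico (min (k i) 0) (max (k i) 0), e.repr s i + w i = k i * w (τ i) + m}

theorem translate_parallelepiped_eq_box {d : ℕ} (e : Module.Basis (Fin d) ℝ (Fin d → ℝ))
    (v : Fin d → ℝ) : (fun x => v + x) '' parallelepiped e = box e (e.repr v) := by
  ext x
  rw [parallelepiped_basis_eq, Set.image_add_left, Set.mem_preimage, Set.mem_ofPred_eq, box,
    Set.mem_ofPred_eq]
  refine forall_congr' fun i => ?_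
  rw [map_add, map_neg, Finsupp.add_apply, Finsupp.neg_apply, Set.mem_Icc, Set.mem_Icc]
  constructor <;> rintro ⟨h1, h2⟩ <;> constructor <;> linarith

theorem box_eq_translate_parallelepiped {d : ℕ} (e : Module.Basis (Fin d) ℝ (Fin d → ℝ))
    (w : Fin d → ℝ) :
    box e w = (fun x => e.equivFun.symm w + x) '' parallelepiped e := by
  rw [translate_parallelepiped_eq_box]
  congr 1
  exact (e.equivFun.apply_symm_apply w).symm

theorem isCompact_box {d : ℕ} (e : Module.Basis (Fin d) ℝ (Fin d → ℝ)) (w : Fin d → ℝ) :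
    IsCompact (box e w) := by
  rw [box_eq_translate_parallelepiped, parallelepiped]
  exact (isCompact_Icc.image (by fun_prop)).image (by fun_prop)

theorem repr_mulVec_of_mulVec_basis {d : ℕ} {e : Module.Basis (Fin d) ℝ (Fin d → ℝ)}
    {τ : Equiv.Perm (Fin d)} {k : Fin d → ℤ} {M : Matrix (Fin d) (Fin d) ℝ}
    (h : ∀ i, M *ᵥ e (τ i) = (k i : ℝ) • e i) (x : Fin d → ℝ) (i : Fin d) :
    e.repr (M *ᵥ x) i = k i * e.repr x (τ i) := by
  have : e.coord i ∘ₗ Matrix.toLin' M = (k i : ℝ) • e.coord (τ i) := by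
    refine e.ext fun j => ?_
    obtain ⟨l, rfl⟩ := τ.surjective j
    by_cases hl : l = i <;> simp [h, hl]
  simpa using LinearMap.congr_fun this x

/-- The segment `[0, k]` (or `[k, 0]`) is the union of the unit segments `[m, m + 1]`. -/
theorem mem_Icc_iff_exists_mul_sub_mem_Icc {k : ℤ} (hk : k ≠ 0) (u : ℝ) :
    u ∈ Set.Icc (0 : ℝ) 1 ↔
      ∃ m ∈ Finset.Ico (min k 0) (max k 0), k * u - m ∈ Set.Icc (0 : ℝ) 1 := by
  simp only [Finset.mem_Ico, Set.mem_Icc]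
  constructor
  · rintro ⟨h0, h1⟩
    rcases lt_or_gt_of_ne hk with hneg | hpos
    · have hk' : (k : ℝ) < 0 := by exact_mod_cast hneg
      rw [min_eq_left hneg.le, max_eq_right hneg.le]
      refine ⟨(⌈(k : ℝ) * u⌉ - 1) ⊔ k, ⟨le_max_right _ _, max_lt ?_ hneg⟩, ?_⟩
      · have : ⌈(k : ℝ) * u⌉ ≤ 0 := Int.ceil_le.2 (by push_cast; nlinarith)
        omega
      · rcases max_cases (⌈(k : ℝ) * u⌉ - 1) k with ⟨h, _⟩ | ⟨h, h'⟩
        · rw [h]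
          push_cast
          constructor <;> linarith [Int.le_ceil ((k : ℝ) * u), Int.ceil_lt_add_one ((k : ℝ) * u)]
        · rw [h]
          have h2 : ⌈(k : ℝ) * u⌉ ≤ k := by omega
          have h3 : (k : ℝ) * u ≤ k := Int.ceil_le.1 h2
          constructor <;> nlinarith
    · have hk' : (0 : ℝ) < k := by exact_mod_cast hpos
      rw [min_eq_right hpos.le, max_eq_left hpos.le]
      refine ⟨⌊(k : ℝ) * u⌋ ⊓ (k - 1), ⟨le_min ?_ (by omega), min_lt_of_right_lt (by omega)⟩, ?_⟩
      · exact Int.floor_nonneg.2 (by positivity)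
      · rcases min_cases ⌊(k : ℝ) * u⌋ (k - 1) with ⟨h, _⟩ | ⟨h, h'⟩
        · rw [h]
          constructor <;> linarith [Int.floor_le ((k : ℝ) * u), Int.lt_floor_add_one ((k : ℝ) * u)]
        · rw [h]
          have h2 : k ≤ ⌊(k : ℝ) * u⌋ := by omega
          have h3 : (k : ℝ) ≤ k * u := Int.le_floor.1 h2
          push_cast
          constructor <;> nlinarith
  · rintro ⟨m, ⟨hm1, hm2⟩, h0, h1⟩
    rcases lt_or_gt_of_ne hk with hneg | hpos
    · rw [min_eq_left hneg.le] at hm1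
      rw [max_eq_right hneg.le] at hm2
      have hk' : (k : ℝ) < 0 := by exact_mod_cast hneg
      have h2 : (k : ℝ) ≤ m := by exact_mod_cast hm1
      have h3 : (m : ℝ) + 1 ≤ 0 := by exact_mod_cast hm2
      constructor <;> nlinarith
    · rw [min_eq_right hpos.le] at hm1
      rw [max_eq_left hpos.le] at hm2
      have hk' : (0 : ℝ) < k := by exact_mod_cast hpos
      have h2 : (0 : ℝ) ≤ m := by exact_mod_cast hm1
      have h3 : (m : ℝ) + 1 ≤ k := by exact_mod_cast hm2
      constructor <;> nlinarith

theorem finite_gridShifts {d : ℕ} (e : Module.Basis (Fin d) ℝ (Fin d → ℝ))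
    (τ : Equiv.Perm (Fin d)) (k : Fin d → ℤ) (w : Fin d → ℝ) : (gridShifts e τ k w).Finite := by
  have hfin : (Set.univ.pi fun i => (fun m : ℤ => (k i * w (τ i) + m - w i : ℝ)) ''
      (Finset.Ico (min (k i) 0) (max (k i) 0) : Set ℤ)).Finite :=
    Set.Finite.pi fun i => (Finset.finite_toSet _).image _
  refine (hfin.preimage e.equivFun.injective.injOn).subset fun s hs i _ => ?_
  obtain ⟨m, hm, h⟩ := hs i
  refine ⟨m, hm, ?_⟩
  simp only [Module.Basis.equivFun_apply]
  linarith

theorem volume_coord_eq {d : ℕ} (e : Module.Basis (Fin d) ℝ (Fin d → ℝ)) (i : Fin d) (c : ℝ) :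
    MeasureTheory.volume {x : Fin d → ℝ | e.repr x i = c} = 0 := by
  have h : {x : Fin d → ℝ | e.repr x i = c} =
      (((AffineSubspace.mk' (c • e i) (LinearMap.ker (e.coord i))) :
        AffineSubspace ℝ (Fin d → ℝ)) : Set (Fin d → ℝ)) := by
    ext x
    simp [AffineSubspace.mem_mk', sub_eq_zero]
  rw [h]
  refine MeasureTheory.Measure.addHaar_affineSubspace _ _ fun htop => ?_
  have h1 : (c + 1) • e i ∈ {x : Fin d → ℝ | e.repr x i = c} := by
    rw [h, htop]
    trivial
  simp at h1

/-- A box is an attractor for every expanding matrix that maps its edges to nonzero integer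
multiples of edges. -/
theorem isAttractor_box {d : ℕ} {e : Module.Basis (Fin d) ℝ (Fin d → ℝ)}
    {τ : Equiv.Perm (Fin d)} {k : Fin d → ℤ} {M : Matrix (Fin d) (Fin d) ℝ}
    (hM : IsExpanding M) (hk : ∀ i, k i ≠ 0)
    (h : ∀ x i, e.repr (M *ᵥ x) i = k i * e.repr x (τ i)) (w : Fin d → ℝ) :
    IsAttractor M (gridShifts e τ k w) (box e w) where
  expanding := hM
  finite_shifts := finite_gridShifts e τ k w
  nonempty := ⟨e.equivFun.symm w, fun i => by
    rw [show e.repr (e.equivFun.symm w) i = w i from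
      congrFun (e.equivFun.apply_symm_apply w) i]
    simp⟩
  isCompact := isCompact_box e w
  eq_iUnion := by
    ext x
    simp only [Set.mem_iUnion, mem_piece_iff hM.isUnit_det, exists_prop]
    have hx : x ∈ box e w ↔ ∀ i, ∃ m ∈ Finset.Ico (min (k i) 0) (max (k i) 0),
        k i * (e.repr x (τ i) - w (τ i)) - (m : ℝ) ∈ Set.Icc (0 : ℝ) 1 := by
      rw [box, Set.mem_ofPred_eq, τ.surjective.forall]
      refine forall_congr' fun i => ?_
      rw [← mem_Icc_iff_exists_mul_sub_mem_Icc (hk i), Set.mem_Icc, Set.mem_Icc]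
      constructor <;> rintro ⟨h1, h2⟩ <;> constructor <;> linarith
    rw [hx]
    constructor
    · intro hm
      choose m hm hmx using hm
      set s := e.equivFun.symm fun i => k i * w (τ i) + m i - w i with hs
      have hsi : ∀ i, e.repr s i = k i * w (τ i) + m i - w i := fun i =>
        congrFun (e.equivFun.apply_symm_apply _) i
      refine ⟨s, fun i => ⟨m i, hm i, by rw [hsi]; ring⟩, fun i => ?_⟩
      have := hmx i
      rw [map_sub, Finsupp.sub_apply, h, hsi]
      constructor <;> linarith [this.1, this.2]
    · rintro ⟨s, hs, hx⟩ i
      obtain ⟨m, hm, hmi⟩ := hs i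
      have := hx i
      rw [map_sub, Finsupp.sub_apply, h] at this
      refine ⟨m, hm, ?_⟩
      constructor <;> linarith [this.1, this.2]
  null_inter := by
    intro s hs t ht hst
    -- Two distinct shifts differ by a nonzero integer in some coordinate, so that the
    -- intersection of the two pieces lies in a hyperplane.
    obtain ⟨i, hi⟩ : ∃ i, e.repr s i ≠ e.repr t i := by
      by_contra! hall
      exact hst (e.repr.injective (Finsupp.ext hall))
    obtain ⟨m, -, hm⟩ := hs i
    obtain ⟨n, -, hn⟩ := ht i
    have hmn : m ≠ n := by
      rintro rfl
      exact hi (by linarith)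
    refine MeasureTheory.measure_mono_null (fun x hx => ?_)
      (volume_coord_eq e (τ i) (w (τ i) + max m n / k i))
    rw [Set.mem_inter_iff, mem_piece_iff hM.isUnit_det, mem_piece_iff hM.isUnit_det] at hx
    have h1 := hx.1 i
    have h2 := hx.2 i
    rw [map_sub, Finsupp.sub_apply, h] at h1 h2
    have hki : (k i : ℝ) ≠ 0 := by exact_mod_cast hk i
    rw [Set.mem_ofPred_eq, ← sub_eq_iff_eq_add', eq_div_iff hki]
    rcases lt_or_gt_of_ne hmn with hlt | hlt
    · have h3 : (m : ℝ) + 1 ≤ n := by exact_mod_cast hlt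
      rw [max_eq_right (by linarith)]
      linarith [h1.1, h1.2, h2.1, h2.2]
    · have h3 : (n : ℝ) + 1 ≤ m := by exact_mod_cast hlt
      rw [max_eq_left (by linarith)]
      linarith [h1.1, h1.2, h2.1, h2.2]

/-! ### Eigenvalues of expanding matrices -/

theorem mem_spectrum_of_mulVec_eq {K : Type*} [Field K] {d : ℕ} {A : Matrix (Fin d) (Fin d) K}
    {x : Fin d → K} (hx : x ≠ 0) {z : K} (h : A *ᵥ x = z • x) : z ∈ spectrum K A := by
  rw [← Matrix.spectrum_toLin', ← Module.End.hasEigenvalue_iff_mem_spectrum]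
  exact Module.End.hasEigenvalue_of_hasEigenvector
    ⟨Module.End.mem_eigenspace_iff.2 (by simpa using h), hx⟩

theorem IsExpanding.one_lt_abs {d : ℕ} {M : Matrix (Fin d) (Fin d) ℝ} (hM : IsExpanding M)
    {n : ℕ} (hn : 0 < n) {x : Fin d → ℝ} (hx : x ≠ 0) {c : ℝ} (h : M ^ n *ᵥ x = c • x) :
    1 < |c| := by
  have hpow : (c : ℂ) ∈ spectrum ℂ (M.map (algebraMap ℝ ℂ) ^ n) := by
    refine mem_spectrum_of_mulVec_eq (x := algebraMap ℝ ℂ ∘ x) (fun h0 => hx ?_) ?_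
    · ext i
      simpa using congrFun h0 i
    · have hmap : M.map (algebraMap ℝ ℂ) ^ n = (M ^ n).map (algebraMap ℝ ℂ) :=
        (map_pow (algebraMap ℝ ℂ).mapMatrix M n).symm
      ext i
      rw [hmap, ← RingHom.map_mulVec, h]
      simp
  rw [spectrum.map_pow_of_pos _ hn] at hpow
  obtain ⟨z, hz, hzc⟩ := hpow
  have h1 := one_lt_pow₀ (hM z hz) hn.ne'
  rwa [← norm_pow, show z ^ n = c from hzc, Complex.norm_real, Real.norm_eq_abs] at h1

/-- The restriction of an expanding map to an invariant subspace is expanding. -/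
theorem IsExpanding.of_comp_eq {d m : ℕ} {M : Matrix (Fin d) (Fin d) ℝ} (hM : IsExpanding M)
    {N : Matrix (Fin m) (Fin m) ℝ} (P : (Fin m → ℝ) →ₗ[ℝ] (Fin d → ℝ))
    (Q : (Fin d → ℝ) →ₗ[ℝ] (Fin m → ℝ)) (hQP : ∀ x, Q (P x) = x)
    (h : ∀ x, M *ᵥ P x = P (N *ᵥ x)) : IsExpanding N := by
  intro z hz
  have hQP' : LinearMap.toMatrix' Q * LinearMap.toMatrix' P = 1 := by
    rw [← LinearMap.toMatrix'_comp, ← LinearMap.toMatrix'_id]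
    congr 1
    exact LinearMap.ext hQP
  have hMP : M * LinearMap.toMatrix' P = LinearMap.toMatrix' P * N := by
    have : Matrix.toLin' M ∘ₗ P = P ∘ₗ Matrix.toLin' N := LinearMap.ext h
    simpa [LinearMap.toMatrix'_comp] using congrArg LinearMap.toMatrix' this
  rw [← Matrix.spectrum_toLin', ← Module.End.hasEigenvalue_iff_mem_spectrum] at hz
  obtain ⟨x, hx⟩ := hz.exists_hasEigenvector
  have hNx := hx.apply_eq_smul
  rw [Matrix.toLin'_apply] at hNx
  have hmul : ∀ {a b c : ℕ} (A : Matrix (Fin a) (Fin b) ℝ) (B : Matrix (Fin b) (Fin c) ℝ),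
      (A * B).map (algebraMap ℝ ℂ) = A.map (algebraMap ℝ ℂ) * B.map (algebraMap ℝ ℂ) :=
    fun A B => Matrix.map_mul
  refine hM z (mem_spectrum_of_mulVec_eq
    (x := (LinearMap.toMatrix' P).map (algebraMap ℝ ℂ) *ᵥ x) (fun h0 => hx.2 ?_) ?_)
  · have := congrArg ((LinearMap.toMatrix' Q).map (algebraMap ℝ ℂ) *ᵥ ·) h0
    simpa only [Matrix.mulVec_mulVec, ← hmul, hQP', Matrix.map_one _ (map_zero _) (map_one _),
      Matrix.one_mulVec, Matrix.mulVec_zero] using this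
  · rw [Matrix.mulVec_mulVec, ← hmul, hMP, hmul, ← Matrix.mulVec_mulVec, hNx,
      Matrix.mulVec_smul]

/-! ### Irreducibility when the edge directions form one cycle -/

/-- Every edge of a box that is a product lies in one of the two factors: the endpoints `φ (x, y)`
and `φ (x', y')` of an edge have the same midpoint as `φ (x', y)` and `φ (x, y')`, which therefore
lie on the edge, too. -/
theorem symm_basis_fst_eq_zero_or_snd_eq_zero {d d₁ d₂ : ℕ}
    {e : Module.Basis (Fin d) ℝ (Fin d → ℝ)}
    {w : Fin d → ℝ} {G₁ : Set (Fin d₁ → ℝ)} {G₂ : Set (Fin d₂ → ℝ)}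
    (φ : ((Fin d₁ → ℝ) × (Fin d₂ → ℝ)) ≃ₗ[ℝ] (Fin d → ℝ))
    (hG : box e w = φ '' (G₁ ×ˢ G₂)) (i : Fin d) :
    (φ.symm (e i)).1 = 0 ∨ (φ.symm (e i)).2 = 0 := by
  set p := e.equivFun.symm w with hp
  have hpi : ∀ l, e.repr p l = w l := fun l => congrFun (e.equivFun.apply_symm_apply _) l
  have hp0 : p ∈ box e w := fun l => by simp [hpi]
  have hp1 : p + e i ∈ box e w := fun l => by
    by_cases hl : i = l <;> simp [hpi, hl]
  rw [hG] at hp0 hp1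
  obtain ⟨⟨x, y⟩, ⟨hx, hy⟩, hxy⟩ := hp0
  obtain ⟨⟨x', y'⟩, ⟨hx', hy'⟩, hxy'⟩ := hp1
  have hu : φ (x', y) ∈ box e w := hG ▸ ⟨(x', y), ⟨hx', hy⟩, rfl⟩
  have hu' : φ (x, y') ∈ box e w := hG ▸ ⟨(x, y'), ⟨hx, hy'⟩, rfl⟩
  have hsum : φ (x', y) + φ (x, y') = p + (p + e i) := by
    rw [← hxy', ← hxy, ← map_add, ← map_add]
    simp [add_comm]
  set t := e.repr (φ (x', y)) i - w i with ht
  have hline : φ (x', y) = p + t • e i := by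
    refine e.repr.injective (Finsupp.ext fun l => ?_)
    by_cases hl : i = l
    · subst hl
      simp [hpi, ht]
    · have h1 := congrArg (fun v => e.repr v l) hsum
      simp only [map_add, Finsupp.add_apply, hpi, Module.Basis.repr_self,
        Finsupp.single_apply, hl, if_false, add_zero] at h1
      simp only [map_add, map_smul, Finsupp.add_apply, Finsupp.smul_apply, hpi,
        Module.Basis.repr_self, Finsupp.single_apply, hl, if_false, smul_zero, add_zero]
      linarith [(hu l).1, (hu' l).1]
  have h1 : φ (x' - x, 0) = t • e i := by
    rw [show ((x' - x, 0) : (Fin d₁ → ℝ) × (Fin d₂ → ℝ)) = (x', y) - (x, y) by simp, map_sub,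
      hline, hxy]
    simp
  have h2 : φ (0, y' - y) = (1 - t) • e i := by
    rw [show ((0, y' - y) : (Fin d₁ → ℝ) × (Fin d₂ → ℝ)) = (x', y') - (x', y) by simp, map_sub,
      hline, hxy']
    module
  have h1' : t • φ.symm (e i) = (x' - x, 0) := by rw [← map_smul, ← h1, φ.symm_apply_apply]
  have h2' : (1 - t) • φ.symm (e i) = (0, y' - y) := by
    rw [← map_smul, ← h2, φ.symm_apply_apply]
  by_cases ht0 : t = 0
  · left
    simpa [ht0] using congrArg Prod.fst h2'
  · right
    simpa [ht0] using congrArg Prod.snd h1'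

/-- If the edge directions are permuted cyclically, then a nontrivial quotient map commuting
with `M` is nonzero on each of them. -/
theorem map_basis_ne_zero_of_isCycleOn {d m : ℕ} (hm : 0 < m)
    {e : Module.Basis (Fin d) ℝ (Fin d → ℝ)} {τ : Equiv.Perm (Fin d)}
    {k : Fin d → ℤ} {M : Matrix (Fin d) (Fin d) ℝ} (hk : ∀ i, k i ≠ 0)
    (h : ∀ i, M *ᵥ e (τ i) = (k i : ℝ) • e i) (hτ : τ.IsCycleOn Set.univ)
    {f : (Fin d → ℝ) →ₗ[ℝ] (Fin m → ℝ)} (hf : Function.Surjective f)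
    {N : Matrix (Fin m) (Fin m) ℝ} (hN : ∀ x, f (M *ᵥ x) = N *ᵥ f x) (i : Fin d) :
    f (e i) ≠ 0 := by
  intro hi
  have hstep : ∀ l, f (e (τ l)) = 0 → f (e l) = 0 := by
    intro l hl
    have hl' := hN (e (τ l))
    rw [h, hl, Matrix.mulVec_zero, map_smul] at hl'
    exact (smul_eq_zero.1 hl').resolve_left (by exact_mod_cast hk l)
  have hpow : ∀ (n : ℕ) l, f (e ((τ ^ n) l)) = 0 → f (e l) = 0 := by
    intro n
    induction n with
    | zero => simp
    | succ n ih =>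
      intro l hl
      rw [pow_succ', Equiv.Perm.mul_apply] at hl
      exact ih l (hstep _ hl)
  have hall : f = 0 := e.ext fun l => by
    obtain ⟨n, -, hn⟩ := Equiv.Perm.IsCycleOn.exists_pow_eq (s := Finset.univ) (by simpa using hτ)
      (Finset.mem_univ l) (Finset.mem_univ i)
    exact hpow n l (by rw [hn, hi])
  obtain ⟨x, hx⟩ := hf fun _ => 1
  have := congrFun hx ⟨0, hm⟩
  simp [hall] at this

theorem not_isTensorProduct_of_isCycleOn {d : ℕ} {e : Module.Basis (Fin d) ℝ (Fin d → ℝ)}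
    {τ : Equiv.Perm (Fin d)} {k : Fin d → ℤ} {M : Matrix (Fin d) (Fin d) ℝ} (hd : 0 < d)
    (hk : ∀ i, k i ≠ 0) (h : ∀ i, M *ᵥ e (τ i) = (k i : ℝ) • e i) (hτ : τ.IsCycleOn Set.univ)
    (S : Set (Fin d → ℝ)) (w : Fin d → ℝ) : ¬ IsTensorProduct M S (box e w) := by
  rintro ⟨d₁, d₂, hd₁, hd₂, M₁, S₁, G₁, M₂, S₂, G₂, φ, -, -, hφ, -, hG⟩
  have hφ' : ∀ x, φ.symm (M *ᵥ x) = (M₁ *ᵥ (φ.symm x).1, M₂ *ᵥ (φ.symm x).2) := by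
    intro x
    rw [LinearEquiv.symm_apply_eq, ← hφ]
    simp
  rcases symm_basis_fst_eq_zero_or_snd_eq_zero φ hG ⟨0, hd⟩ with h0 | h0
  · exact map_basis_ne_zero_of_isCycleOn hd₁ hk h hτ (N := M₁)
      (f := LinearMap.fst ℝ _ _ ∘ₗ φ.symm.toLinearMap)
      (Prod.fst_surjective.comp φ.symm.surjective) (fun x => by simp [hφ']) _ h0
  · exact map_basis_ne_zero_of_isCycleOn hd₂ hk h hτ (N := M₂)
      (f := LinearMap.snd ℝ _ _ ∘ₗ φ.symm.toLinearMap)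
      (Prod.snd_surjective.comp φ.symm.surjective) (fun x => by simp [hφ']) _ h0

/-! ### Splitting along an invariant set of edges -/

/-- The matrix with entries `k i` at the positions `(i, τ i)` and zeros elsewhere. -/
def monomialMatrix {n : ℕ} (τ : Equiv.Perm (Fin n)) (k : Fin n → ℤ) : Matrix (Fin n) (Fin n) ℝ :=
  Matrix.of fun i j => if j = τ i then (k i : ℝ) else 0

theorem monomialMatrix_mulVec {n : ℕ} (τ : Equiv.Perm (Fin n)) (k : Fin n → ℤ) (x : Fin n → ℝ)
    (i : Fin n) : (monomialMatrix τ k *ᵥ x) i = k i * x (τ i) := by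
  simp [monomialMatrix, Matrix.mulVec, dotProduct]

/-- Coordinates in a basis, distributed to two blocks of indices. -/
noncomputable def blockEquiv {d d₁ d₂ : ℕ} (e : Module.Basis (Fin d) ℝ (Fin d → ℝ))
    (θ : Fin d₁ ⊕ Fin d₂ ≃ Fin d) : ((Fin d₁ → ℝ) × (Fin d₂ → ℝ)) ≃ₗ[ℝ] (Fin d → ℝ) :=
  (LinearEquiv.sumArrowLequivProdArrow (Fin d₁) (Fin d₂) ℝ ℝ).symm ≪≫ₗ
    LinearEquiv.funCongrLeft ℝ ℝ θ.symm ≪≫ₗ e.equivFun.symm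

section blockEquiv

variable {d d₁ d₂ : ℕ} (e : Module.Basis (Fin d) ℝ (Fin d → ℝ)) (θ : Fin d₁ ⊕ Fin d₂ ≃ Fin d)

theorem repr_blockEquiv_inl (z : (Fin d₁ → ℝ) × (Fin d₂ → ℝ)) (a : Fin d₁) :
    e.repr (blockEquiv e θ z) (θ (Sum.inl a)) = z.1 a := by
  refine (congrFun (e.equivFun.apply_symm_apply _) _).trans ?_
  simp [LinearEquiv.funCongrLeft, LinearMap.funLeft_apply]
  rfl

theorem repr_blockEquiv_inr (z : (Fin d₁ → ℝ) × (Fin d₂ → ℝ)) (a : Fin d₂) :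
    e.repr (blockEquiv e θ z) (θ (Sum.inr a)) = z.2 a := by
  refine (congrFun (e.equivFun.apply_symm_apply _) _).trans ?_
  simp [LinearEquiv.funCongrLeft, LinearMap.funLeft_apply]
  rfl

theorem eq_image_blockEquiv {A : Set (Fin d → ℝ)} {A₁ : Set (Fin d₁ → ℝ)}
    {A₂ : Set (Fin d₂ → ℝ)} (h : ∀ z, blockEquiv e θ z ∈ A ↔ z.1 ∈ A₁ ∧ z.2 ∈ A₂) :
    A = blockEquiv e θ '' (A₁ ×ˢ A₂) := by
  ext x
  obtain ⟨z, rfl⟩ := (blockEquiv e θ).surjective x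
  rw [h, (blockEquiv e θ).injective.mem_set_image, Set.mem_prod]

/-- If `τ` preserves a partition of the edges into two nonempty blocks, then the box with its
grid of shifts is the tensor product of the boxes and grids of the two blocks. -/
theorem isTensorProduct_box (hd₁ : 0 < d₁) (hd₂ : 0 < d₂) {M : Matrix (Fin d) (Fin d) ℝ}
    (hM : IsExpanding M) {τ : Equiv.Perm (Fin d)} {k : Fin d → ℤ} (hk : ∀ i, k i ≠ 0)
    (h : ∀ x i, e.repr (M *ᵥ x) i = k i * e.repr x (τ i)) (w : Fin d → ℝ)
    (τ₁ : Equiv.Perm (Fin d₁)) (τ₂ : Equiv.Perm (Fin d₂))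
    (h₁ : ∀ a, τ (θ (Sum.inl a)) = θ (Sum.inl (τ₁ a)))
    (h₂ : ∀ a, τ (θ (Sum.inr a)) = θ (Sum.inr (τ₂ a))) :
    IsTensorProduct M (gridShifts e τ k w) (box e w) := by
  set φ := blockEquiv e θ with hφ
  set k₁ : Fin d₁ → ℤ := fun a => k (θ (Sum.inl a)) with hk₁
  set k₂ : Fin d₂ → ℤ := fun a => k (θ (Sum.inr a)) with hk₂
  have hMφ : ∀ x y, M *ᵥ φ (x, y) =
      φ (monomialMatrix τ₁ k₁ *ᵥ x, monomialMatrix τ₂ k₂ *ᵥ y) := by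
    intro x y
    refine e.repr.injective (Finsupp.ext (θ.surjective.forall.2 (Sum.forall.2 ⟨?_, ?_⟩)))
    · intro a
      rw [h, h₁, repr_blockEquiv_inl, repr_blockEquiv_inl]
      exact (monomialMatrix_mulVec τ₁ k₁ x a).symm
    · intro a
      rw [h, h₂, repr_blockEquiv_inr, repr_blockEquiv_inr]
      exact (monomialMatrix_mulVec τ₂ k₂ y a).symm
  have hM₁ : IsExpanding (monomialMatrix τ₁ k₁) :=
    hM.of_comp_eq (φ.toLinearMap ∘ₗ LinearMap.inl ℝ _ _) (LinearMap.fst ℝ _ _ ∘ₗ φ.symm.toLinearMap)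
      (fun x => by simp) (fun x => by simp [hMφ])
  have hM₂ : IsExpanding (monomialMatrix τ₂ k₂) :=
    hM.of_comp_eq (φ.toLinearMap ∘ₗ LinearMap.inr ℝ _ _) (LinearMap.snd ℝ _ _ ∘ₗ φ.symm.toLinearMap)
      (fun x => by simp) (fun x => by simp [hMφ])
  refine ⟨d₁, d₂, hd₁, hd₂, monomialMatrix τ₁ k₁,
    gridShifts (Pi.basisFun ℝ _) τ₁ k₁ fun a => w (θ (Sum.inl a)),
    box (Pi.basisFun ℝ _) fun a => w (θ (Sum.inl a)), monomialMatrix τ₂ k₂,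
    gridShifts (Pi.basisFun ℝ _) τ₂ k₂ fun a => w (θ (Sum.inr a)),
    box (Pi.basisFun ℝ _) fun a => w (θ (Sum.inr a)), φ,
    isAttractor_box hM₁ (fun a => hk _) (monomialMatrix_mulVec τ₁ k₁) _,
    isAttractor_box hM₂ (fun a => hk _) (monomialMatrix_mulVec τ₂ k₂) _,
    hMφ, eq_image_blockEquiv e θ fun z => ?_, eq_image_blockEquiv e θ fun z => ?_⟩
  · simp only [gridShifts, Set.mem_ofPred_eq, θ.surjective.forall, Sum.forall,
      repr_blockEquiv_inl, repr_blockEquiv_inr, h₁, h₂, Pi.basisFun_repr, hk₁, hk₂]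
  · simp only [box, Set.mem_ofPred_eq, θ.surjective.forall, Sum.forall,
      repr_blockEquiv_inl, repr_blockEquiv_inr, Pi.basisFun_repr]

end blockEquiv

theorem isTensorProduct_box_of_not_isCycleOn {d : ℕ} {e : Module.Basis (Fin d) ℝ (Fin d → ℝ)}
    {M : Matrix (Fin d) (Fin d) ℝ} (hM : IsExpanding M) {τ : Equiv.Perm (Fin d)} {k : Fin d → ℤ}
    (hk : ∀ i, k i ≠ 0) (h : ∀ x i, e.repr (M *ᵥ x) i = k i * e.repr x (τ i)) (w : Fin d → ℝ)
    (hτ : ¬ τ.IsCycleOn Set.univ) : IsTensorProduct M (gridShifts e τ k w) (box e w) := by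
  classical
  have hxy : ∃ x y, ¬ τ.SameCycle x y := by
    by_contra! hall
    exact hτ ⟨Set.bijOn_univ.2 τ.bijective, fun x _ y _ => hall x y⟩
  obtain ⟨x, y, hxy⟩ := hxy
  set p : Fin d → Prop := fun i => τ.SameCycle x i with hp
  have hpτ : ∀ i, p (τ i) ↔ p i := fun i => Equiv.Perm.sameCycle_apply_right
  have hqτ : ∀ i, ¬ p (τ i) ↔ ¬ p i := fun i => not_congr (hpτ i)
  set f₁ := Fintype.equivFin {i // p i} with hf₁
  set f₂ := Fintype.equivFin {i // ¬ p i} with hf₂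
  refine isTensorProduct_box e ((f₁.sumCongr f₂).symm.trans (Equiv.sumCompl p))
    (Fintype.card_pos_iff.2 ⟨⟨x, Equiv.Perm.SameCycle.refl τ x⟩⟩)
    (Fintype.card_pos_iff.2 ⟨⟨y, hxy⟩⟩) hM hk h w
    (f₁.permCongr (τ.subtypePerm hpτ)) (f₂.permCongr (τ.subtypePerm hqτ)) ?_ ?_
  · intro a
    simp [Equiv.permCongr_apply]
  · intro a
    simp [Equiv.permCongr_apply]

/-! ### The cyclic form -/

/-- The nonzero entries of `cyclicMatrix ε p`, row by row. -/
def cyclicWeight {d : ℕ} (ε : ℤˣ) (p : Fin d → ℕ) (i : Fin d) : ℤ :=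
  if (i : ℕ) + 1 = d then (ε : ℤ) * p i else p i

theorem coe_finRotate_eq {d : ℕ} (i : Fin d) :
    (finRotate d i : ℕ) = if (i : ℕ) + 1 = d then 0 else (i : ℕ) + 1 := by
  cases d with
  | zero => exact i.elim0
  | succ n => rw [coe_finRotate]; simp [Fin.ext_iff]

theorem cyclicMatrix_apply {d : ℕ} (ε : ℤˣ) (p : Fin d → ℕ) (i j : Fin d) :
    cyclicMatrix ε p i j = if j = finRotate d i then cyclicWeight ε p i else 0 := by
  have hj := j.2
  simp only [cyclicMatrix, Matrix.of_apply, Fin.ext_iff, coe_finRotate_eq, cyclicWeight]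
  by_cases hi : (i : ℕ) + 1 = d
  · rw [if_neg (by omega)]
    simp [hi]
  · simp [hi]

theorem cyclicWeight_ne_zero {d : ℕ} {ε : ℤˣ} {p : Fin d → ℕ} (hp : ∀ i, 0 < p i) (i : Fin d) :
    cyclicWeight ε p i ≠ 0 := by
  have := (hp i).ne'
  unfold cyclicWeight
  split_ifs <;> simp [this]

theorem abs_cyclicWeight {d : ℕ} (ε : ℤˣ) (p : Fin d → ℕ) (i : Fin d) :
    |cyclicWeight ε p i| = p i := by
  unfold cyclicWeight
  rcases Int.units_eq_one_or ε with rfl | rfl <;> split_ifs <;> simp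

theorem abs_det_cyclicMatrix {d : ℕ} (ε : ℤˣ) (p : Fin d → ℕ) :
    |(cyclicMatrix ε p).det| = ∏ i, (p i : ℤ) := by
  have : cyclicMatrix ε p =
      Matrix.diagonal (cyclicWeight ε p) * (finRotate d).permMatrix ℤ := by
    ext i j
    rw [cyclicMatrix_apply, Matrix.diagonal_mul, Equiv.Perm.permMatrix, PEquiv.toMatrix_apply]
    simp [Equiv.toPEquiv_apply, eq_comm]
  rw [this, Matrix.det_mul, Matrix.det_diagonal, Matrix.det_permutation, abs_mul,
    Finset.abs_prod, Finset.prod_congr rfl fun i _ => abs_cyclicWeight ε p i]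
  rcases Int.units_eq_one_or (Equiv.Perm.sign (finRotate d)) with h | h <;> simp [h]

theorem toMatrix_eq_cyclicMatrix_iff {d : ℕ} (M : Matrix (Fin d) (Fin d) ℝ)
    (b : Module.Basis (Fin d) ℝ (Fin d → ℝ)) (ε : ℤˣ) (p : Fin d → ℕ) :
    LinearMap.toMatrix b b (Matrix.toLin' M) = (cyclicMatrix ε p).map (Int.cast : ℤ → ℝ) ↔
      ∀ i, M *ᵥ b (finRotate d i) = (cyclicWeight ε p i : ℝ) • b i := by
  have key : ∀ i, M *ᵥ b (finRotate d i) = (cyclicWeight ε p i : ℝ) • b i ↔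
      ∀ l, LinearMap.toMatrix b b (Matrix.toLin' M) l (finRotate d i) =
        ((cyclicMatrix ε p l (finRotate d i) : ℤ) : ℝ) := by
    intro i
    rw [← b.repr.injective.eq_iff, Finsupp.ext_iff]
    refine forall_congr' fun l => ?_
    simp only [LinearMap.toMatrix_apply, Matrix.toLin'_apply, cyclicMatrix_apply,
      (finRotate d).injective.eq_iff]
    by_cases hl : i = l <;> simp [hl]
  simp only [key, ← Matrix.ext_iff, Matrix.map_apply]
  rw [forall_comm, (finRotate d).surjective.forall]

theorem isCycleOn_finRotate (d : ℕ) : (finRotate d).IsCycleOn Set.univ := by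
  rcases Nat.lt_or_ge d 2 with hd | hd
  · have : Subsingleton (Fin d) := Fin.subsingleton_iff_le_one.2 (by omega)
    exact Equiv.Perm.isCycleOn_of_subsingleton _ _
  · have h := (isCycle_finRotate_of_le hd).isCycleOn
    have hs : {x | finRotate d x ≠ x} = Set.univ := by
      ext x
      have := Finset.mem_univ x
      rw [← support_finRotate_of_le hd, Equiv.Perm.mem_support] at this
      simpa using this
    rwa [hs] at h

theorem HasCyclicForm.prod_eq_abs_det {d : ℕ} {M : Matrix (Fin d) (Fin d) ℤ}
    {b : Module.Basis (Fin d) ℝ (Fin d → ℝ)} {ε : ℤˣ} {p : Fin d → ℕ}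
    (h : HasCyclicForm M b ε p) : ∏ i, (p i : ℤ) = |M.det| := by
  have hcast : ∀ A : Matrix (Fin d) (Fin d) ℤ, (A.map (Int.cast : ℤ → ℝ)).det = (A.det : ℝ) :=
    fun A => ((Int.castRingHom ℝ).map_det A).symm
  have hdet := congrArg Matrix.det h.2.2
  rw [LinearMap.det_toMatrix, LinearMap.det_toLin', hcast, hcast, Int.cast_inj] at hdet
  rw [hdet, abs_det_cyclicMatrix]

/-! ### Integer vectors -/

theorem IsIntegerVector.sub {d : ℕ} {x y : Fin d → ℝ} (hx : IsIntegerVector x)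
    (hy : IsIntegerVector y) : IsIntegerVector (x - y) := by
  obtain ⟨a, rfl⟩ := hx
  obtain ⟨b, rfl⟩ := hy
  exact ⟨a - b, by ext; simp⟩

theorem IsIntegerVector.sum_intCast_smul {d : ℕ} {x : Fin d → Fin d → ℝ}
    (hx : ∀ i, IsIntegerVector (x i)) (m : Fin d → ℤ) :
    IsIntegerVector (∑ i, (m i : ℝ) • x i) := by
  choose a ha using hx
  refine ⟨∑ i, m i • a i, ?_⟩
  ext j
  simp [ha, Finset.sum_apply]

theorem IsIntegerVector.pow_mulVec {d : ℕ} {x : Fin d → ℝ} (hx : IsIntegerVector x)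
    (M : Matrix (Fin d) (Fin d) ℤ) (n : ℕ) :
    IsIntegerVector ((M.map (Int.cast : ℤ → ℝ)) ^ n *ᵥ x) := by
  obtain ⟨a, rfl⟩ := hx
  refine ⟨(M ^ n) *ᵥ a, ?_⟩
  have hpow : (M.map (Int.cast : ℤ → ℝ)) ^ n = (M ^ n).map (Int.cast : ℤ → ℝ) :=
    (map_pow (Int.castRingHom ℝ).mapMatrix M n).symm
  ext i
  rw [hpow]
  exact (RingHom.map_mulVec (Int.castRingHom ℝ) (M ^ n) a i).symm

/-! ### From the cyclic form to a box-attractor -/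

theorem HasCyclicForm.exists_irreducible_box {d : ℕ} (hd : 0 < d) {M : Matrix (Fin d) (Fin d) ℤ}
    (hM : IsExpanding (M.map (Int.cast : ℤ → ℝ)))
    {b : Module.Basis (Fin d) ℝ (Fin d → ℝ)} {ε : ℤˣ} {p : Fin d → ℕ}
    (h : HasCyclicForm M b ε p) :
    ∃ S G : Set (Fin d → ℝ), (∀ s ∈ S, IsIntegerVector s) ∧
      IsIrreducibleAttractor (M.map (Int.cast : ℤ → ℝ)) S G ∧ IsParallelepiped G := by
  obtain ⟨hb, hp, hMb⟩ := h
  rw [toMatrix_eq_cyclicMatrix_iff] at hMb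
  refine ⟨gridShifts b (finRotate d) (cyclicWeight ε p) 0, box b 0, fun s hs => ?_,
    ⟨isAttractor_box hM (cyclicWeight_ne_zero hp) (repr_mulVec_of_mulVec_basis hMb) 0,
      not_isTensorProduct_of_isCycleOn hd (cyclicWeight_ne_zero hp) hMb (isCycleOn_finRotate d)
        _ _⟩, ⟨_, b, box_eq_translate_parallelepiped b 0⟩⟩
  choose m _ hm using hs
  rw [← b.sum_repr s]
  simp only [Pi.zero_apply, mul_zero, add_zero, zero_add] at hm
  simp only [hm]
  exact IsIntegerVector.sum_intCast_smul hb m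

/-! ### From a box-attractor to the cyclic form -/

/-- A matrix that generates a box permutes the edge directions, with integer factors. -/
theorem IsAttractor.exists_perm {d : ℕ} {M : Matrix (Fin d) (Fin d) ℝ}
    {S : Set (Fin d → ℝ)} {v : Fin d → ℝ} {e : Module.Basis (Fin d) ℝ (Fin d → ℝ)}
    (h : IsAttractor M S ((fun x => v + x) '' parallelepiped e)) :
    ∃ (τ : Equiv.Perm (Fin d)) (k : Fin d → ℤ), (∀ i, k i ≠ 0) ∧
      ∀ i, M *ᵥ e (τ i) = (k i : ℝ) • e i := by
  choose t k hk ht using h.exists_mulVec_basis_eq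
  have hinj : Function.Injective t := by
    intro i j hij
    have hsmul : (k i : ℝ) • e i = (k j : ℝ) • e j := by rw [← ht, ← ht, hij]
    by_contra hne
    have := congrArg (fun x => e.repr x i) hsmul
    simp [Ne.symm hne, hk i] at this
  exact ⟨Equiv.ofBijective t (Finite.injective_iff_bijective.1 hinj), k, hk, ht⟩

theorem pow_mulVec_basis {d : ℕ} {e : Module.Basis (Fin d) ℝ (Fin d → ℝ)}
    {τ : Equiv.Perm (Fin d)} {k : Fin d → ℤ} {M : Matrix (Fin d) (Fin d) ℝ}
    (h : ∀ i, M *ᵥ e (τ i) = (k i : ℝ) • e i) (n : ℕ) (i : Fin d) :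
    M ^ n *ᵥ e ((τ ^ n) i) = ((∏ m ∈ Finset.range n, k ((τ ^ m) i) : ℤ) : ℝ) • e i := by
  induction n with
  | zero => simp
  | succ n ih =>
    rw [pow_succ, pow_succ' τ, Equiv.Perm.mul_apply, ← Matrix.mulVec_mulVec, h,
      Matrix.mulVec_smul, ih, smul_smul, Finset.prod_range_succ]
    push_cast
    rw [mul_comm]

/-- An edge direction stretched by a factor of absolute value at least two is the difference of
two shifts of the grid. -/
theorem isIntegerVector_basis_of_gridShifts {d : ℕ} {e : Module.Basis (Fin d) ℝ (Fin d → ℝ)}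
    {τ : Equiv.Perm (Fin d)} {k : Fin d → ℤ} {w : Fin d → ℝ} (hk : ∀ i, k i ≠ 0)
    (hS : ∀ s ∈ gridShifts e τ k w, IsIntegerVector s) {j : Fin d} (hj : |k j| ≠ 1) :
    IsIntegerVector (e j) := by
  set s := e.equivFun.symm fun i => k i * w (τ i) + (min (k i) 0 : ℤ) - w i with hs
  have hsi : ∀ i, e.repr s i = k i * w (τ i) + (min (k i) 0 : ℤ) - w i := fun i =>
    congrFun (e.equivFun.apply_symm_apply _) i
  have hs1 : s ∈ gridShifts e τ k w := fun i =>
    ⟨min (k i) 0, by have := hk i; rw [Finset.mem_Ico]; omega, by rw [hsi]; ring⟩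
  have hs2 : s + e j ∈ gridShifts e τ k w := by
    intro i
    have hki := hk i
    by_cases hi : j = i
    · subst hi
      have h1 : k j ≠ 1 ∧ k j ≠ -1 := by
        constructor <;> intro h1 <;> simp [h1] at hj
      refine ⟨min (k j) 0 + 1, by rw [Finset.mem_Ico]; omega, ?_⟩
      rw [map_add, Finsupp.add_apply, hsi]
      simp
      ring
    · refine ⟨min (k i) 0, by rw [Finset.mem_Ico]; omega, ?_⟩
      rw [map_add, Finsupp.add_apply, hsi]
      simp [hi]
  simpa using (hS _ hs2).sub (hS _ hs1)

/-- The orbit `M ^ (d - 1) e, …, M e, e` of an integer edge `e` is an integer basis in which the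
matrix is cyclic, with all `p i` except the last one equal to one. -/
theorem exists_hasCyclicForm_of_isCycleOn {d : ℕ} (hd : 0 < d) {M : Matrix (Fin d) (Fin d) ℤ}
    {e : Module.Basis (Fin d) ℝ (Fin d → ℝ)} {τ : Equiv.Perm (Fin d)} {k : Fin d → ℤ}
    (hk : ∀ i, k i ≠ 0) (h : ∀ i, M.map (Int.cast : ℤ → ℝ) *ᵥ e (τ i) = (k i : ℝ) • e i)
    (hτ : τ.IsCycleOn Set.univ) {a : Fin d} (ha : IsIntegerVector (e a)) :
    ∃ (b : Module.Basis (Fin d) ℝ (Fin d → ℝ)) (ε : ℤˣ) (p : Fin d → ℕ),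
      HasCyclicForm M b ε p := by
  set A := M.map (Int.cast : ℤ → ℝ) with hA
  have hτ' : τ.IsCycleOn ((Finset.univ : Finset (Fin d)) : Set (Fin d)) := by simpa using hτ
  have hd' : (Finset.univ : Finset (Fin d)).card = d := by simp
  -- `π` lists the edge directions in the order in which the orbit of `e a` meets them.
  set π : Fin d → Fin d := fun j => (τ⁻¹ ^ (d - 1 - (j : ℕ))) a with hπ
  have hπb : Function.Bijective π := by
    rw [← Finite.surjective_iff_bijective]
    intro i
    obtain ⟨n, hn, hni⟩ := hτ'.inv.exists_pow_eq (Finset.mem_univ a) (Finset.mem_univ i)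
    rw [hd'] at hn
    refine ⟨⟨d - 1 - n, by omega⟩, ?_⟩
    rw [hπ]
    simp only
    rw [show d - 1 - (d - 1 - n) = n by omega, hni]
  set c : Fin d → ℤ := fun j => ∏ m ∈ Finset.range (d - 1 - (j : ℕ)), k ((τ ^ m) (π j)) with hc
  have hc0 : ∀ j, IsUnit (c j : ℝ) := fun j => by
    rw [isUnit_iff_ne_zero]
    exact_mod_cast Finset.prod_ne_zero_iff.2 fun m _ => hk _
  set b := (e.reindex (Equiv.ofBijective π hπb).symm).isUnitSMul hc0 with hb
  have hbj : ∀ j, b j = A ^ (d - 1 - (j : ℕ)) *ᵥ e a := by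
    intro j
    have := pow_mulVec_basis h (d - 1 - (j : ℕ)) (π j)
    rw [show (τ ^ (d - 1 - (j : ℕ))) (π j) = a by simp [hπ, inv_pow]] at this
    rw [this, hb, Module.Basis.isUnitSMul_apply, Module.Basis.reindex_apply]
    rfl
  set C : ℤ := ∏ m ∈ Finset.range d, k ((τ ^ m) a) with hC
  have hC0 : C ≠ 0 := Finset.prod_ne_zero_iff.2 fun m _ => hk _
  have hAd : A ^ d *ᵥ e a = (C : ℝ) • e a := by
    have := pow_mulVec_basis h d a
    rwa [show (τ ^ d) a = a by
      simpa only [hd'] using hτ'.pow_card_apply (Finset.mem_univ a)] at this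
  obtain ⟨ε, hε⟩ : ∃ ε : ℤˣ, C = ε * (C.natAbs : ℤ) := by
    rcases Int.natAbs_eq C with h | h
    · exact ⟨1, by simpa using h⟩
    · exact ⟨-1, by simpa using h⟩
  refine ⟨b, ε, fun i => if (i : ℕ) + 1 = d then C.natAbs else 1, fun i => ?_, fun i => ?_, ?_⟩
  · rw [hbj]
    exact ha.pow_mulVec M _
  · dsimp only
    split_ifs
    · exact Int.natAbs_pos.2 hC0
    · exact one_pos
  · rw [toMatrix_eq_cyclicMatrix_iff]
    intro i
    rw [hbj, hbj, Matrix.mulVec_mulVec, ← pow_succ', coe_finRotate_eq, cyclicWeight]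
    by_cases hi : (i : ℕ) + 1 = d
    · simp only [hi, if_true]
      rw [← hε, show d - 1 - 0 + 1 = d by omega, hAd, show d - 1 - (i : ℕ) = 0 by omega]
      simp
    · simp only [hi, if_false]
      rw [show d - 1 - ((i : ℕ) + 1) + 1 = d - 1 - (i : ℕ) by omega]
      simp only [Nat.cast_one, Int.cast_one, one_smul]
      rfl

theorem exists_hasCyclicForm_of_irreducible_box {d : ℕ} (hd : 0 < d)
    {M : Matrix (Fin d) (Fin d) ℤ} {S G : Set (Fin d → ℝ)} (hS : ∀ s ∈ S, IsIntegerVector s)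
    (hirr : IsIrreducibleAttractor (M.map (Int.cast : ℤ → ℝ)) S G) (hG : IsParallelepiped G) :
    ∃ (b : Module.Basis (Fin d) ℝ (Fin d → ℝ)) (ε : ℤˣ) (p : Fin d → ℕ),
      HasCyclicForm M b ε p := by
  obtain ⟨hatt, hnot⟩ := hirr
  have hM := hatt.expanding
  obtain ⟨v, e, rfl⟩ := id hG
  obtain ⟨τ, k, hk, hτk⟩ := hatt.exists_perm
  have hrepr := repr_mulVec_of_mulVec_basis hτk
  have hbox := translate_parallelepiped_eq_box e v
  have hSgrid : S = gridShifts e τ k (e.repr v) :=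
    hatt.shifts_unique (hbox ▸ isAttractor_box hM hk hrepr (e.repr v)) hG
  have hτ : τ.IsCycleOn Set.univ := by
    by_contra hτ
    rw [hbox, hSgrid] at hnot
    exact hnot (isTensorProduct_box_of_not_isCycleOn hM hk hrepr _ hτ)
  -- If all factors were `±1`, then a power of the matrix would have the eigenvalue `±1`.
  obtain ⟨j, hj⟩ : ∃ j, |k j| ≠ 1 := by
    by_contra! hall
    have hτd : (τ ^ d) ⟨0, hd⟩ = ⟨0, hd⟩ := by
      have := Equiv.Perm.IsCycleOn.pow_card_apply (s := Finset.univ) (by simpa using hτ)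
        (Finset.mem_univ (⟨0, hd⟩ : Fin d))
      simpa using this
    have hpow := pow_mulVec_basis hτk d ⟨0, hd⟩
    rw [hτd] at hpow
    have hlt := hM.one_lt_abs hd (e.ne_zero _) hpow
    rw [← Int.cast_abs, Finset.abs_prod, Finset.prod_congr rfl fun m _ => hall _] at hlt
    simp at hlt
  rw [hSgrid] at hS
  exact exists_hasCyclicForm_of_isCycleOn hd hk hτk hτ
    (isIntegerVector_basis_of_gridShifts hk hS hj)

end BoxAttractor

open BoxAttractor in
theorem mainTheorem3 (d : ℕ) (hd : 0 < d) (M : Matrix (Fin d) (Fin d) ℤ)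
    (hM : IsExpanding (M.map (Int.cast : ℤ → ℝ))) :
    ((∃ S G : Set (Fin d → ℝ), (∀ s ∈ S, IsIntegerVector s) ∧
        IsIrreducibleAttractor (M.map (Int.cast : ℤ → ℝ)) S G ∧ IsParallelepiped G) ↔
      ∃ (b : Module.Basis (Fin d) ℝ (Fin d → ℝ)) (ε : ℤˣ) (p : Fin d → ℕ),
        HasCyclicForm M b ε p ∧ ∏ i, (p i : ℤ) = |M.det|) ∧
    (∀ (b : Module.Basis (Fin d) ℝ (Fin d → ℝ)) (ε : ℤˣ) (p : Fin d → ℕ),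
      HasCyclicForm M b ε p → ∏ i, (p i : ℤ) = |M.det|) := by
  refine ⟨⟨?_, ?_⟩, fun b ε p h => h.prod_eq_abs_det⟩
  · rintro ⟨S, G, hS, hirr, hG⟩
    obtain ⟨b, ε, p, h⟩ := exists_hasCyclicForm_of_irreducible_box hd hS hirr hG
    exact ⟨b, ε, p, h, h.prod_eq_abs_det⟩
  · rintro ⟨b, ε, p, h, -⟩
    exact h.exists_irreducible_box hd hM
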